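/- Conventions. A graph $\Gamma$ consists of a vertex set $V$, a set $\vec E$ of directed edges with a fixed-point-free involution $e\mapsto e^{-1}$, and a terminus map $\tau:\vec E\to V$; loops and multiple edges are allowed. Automorphisms are pairs of bijections of $V$ and $\vec E$ commuting with these maps, and for a colouring $c$ of $\vec E$, $\mathrm{Aut}_c(\Gamma)$ is the group of automorphisms preserving $c$. For a cardinal $n$, $\Gamma$ is $n$-Cayley over a subgroup $H\le\mathrm{Aut}(\Gamma)$ if $H$ acts freely (semi-regularly) on $V$ with exactly $n$ orbits; bi-Cayley means $2$-Cayley over some $H$. (Vertex-transitivity of $\Gamma$ is not required.) A group acts regularly on a non-empty set of vertices if it preserves it and acts freely and transitively on it. Partite presentations. A partite presentation $P=\langle X\mid\mathcal U\mid\mathcal I\mid\phi\mid\mathcal R\rangle$ consists of a set $X$; a set $\mathcal S=\mathcal U\sqcup\mathcal I$ of generators, with the group $MF_P=\langle\mathcal S\mid s^2\ (s\in\mathcal I)\rangle$; a map $\phi:\mathcal S\to\mathrm{Sym}_X$ such that $\phi(s)$ is a fixed-point-free involution for $s\in\mathcal I$ and the right action $x\cdot(s_1\cdots s_n)=\phi(s_n)\circ\cdots\circ\phi(s_1)(x)$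 of $MF_P$ on $X$ is transitive; and for each $x\in X$ a set $\mathcal R_x\subseteq W_{x,x}$, where $W_{x,y}=\{w\in MF_P: x\cdot w=y\}$. Put $R_x=\langle wrw^{-1}: y\in X,\ w\in W_{x,y},\ r\in\mathcal R_y\rangle\trianglelefteq W_{x,x}$ and let $G_x=W_{x,x}/R_x$ be the vertex group. Let $T_P$ be the tree with vertex set $MF_P$ and directed edges $(w,ws)$, $s\in\mathcal S\cup\mathcal S^{-1}$, coloured by $c(w,ws)=s$. Fix $b\in X$, let $\tilde V_x=W_{b,x}$, and write $u\sim v$ if $u,v\in\tilde V_x$ and $u^{-1}v\in R_x$ for some $x$; two edges are equivalent if they have the same colour and equivalent initial and terminal vertices. The partite Cayley graph $\mathrm{Sp}(P)$ is $T_P/\!\sim$, with the induced colouring $c$, and $V_x$ is the image of $\tilde V_x$. 2-partite presentations. A 2-partite presentation $P=\langle\mathcal S_1,\mathcal U,\mathcal I\mid\mathcal R_0,\mathcal R_1\rangle$ consists of pairwise disjoint sets $\mathcal S_1,\mathcal U,\mathcal I$ with $\mathcal S_2=\mathcal U\cup\mathcal I\neq\emptyset$, and two sets $\mathcal R_0,\mathcal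 R_1\subseteq K$, where $MF_P=\langle\mathcal S_1\cup\mathcal S_2\mid s^2\ (s\in\mathcal I)\rangle$ and $K$ is the kernel of the homomorphism $MF_P\to\mathbb Z/2$ sending $\mathcal S_1$ to $0$ and $\mathcal S_2$ to $1$. For $i\in\mathbb Z/2$, $R_i$ is the normal closure in $K$ of $\mathcal R_i\cup\{srs^{-1}: r\in\mathcal R_{i+1},\ s\in\mathcal S_2\}$, $G_i=K/R_i$, $\tilde V_0=K$ and $\tilde V_1=MF_P\setminus K=\mathcal S_2K$; $\sim$, $\mathrm{Sp}(P)=T_P/\!\sim$, $c$ and $V_i$ are defined as above. Proposition. (1) Let $P$ be a partite presentation, $b,x\in X$ and $p\in\tilde V_x$. There is an injective homomorphism $\iota:G_x\to\mathrm{Aut}_c(\mathrm{Sp}(P))$, given on vertices by $\iota(gR_x)[h]=[pgp^{-1}h]$ for $g\in W_{x,x}$ and $h\in MF_P$. Through $\iota$, $G_x$ acts regularly on $V_x$, and in fact on $V_y$ for every $y\in X$; hence $\mathrm{Sp}(P)$ is $|X|$-Cayley over the image of $G_x$. (2) Let $P$ be a 2-partite presentation, $i\in\mathbb Z/2$ and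 $p\in\tilde V_i$. There is an injective homomorphism $\iota:G_i\to\mathrm{Aut}_c(\mathrm{Sp}(P))$, given on vertices by $\iota(gR_i)[h]=[pgp^{-1}h]$ for $g\in K$ and $h\in MF_P$. Through $\iota$, $G_i$ acts regularly on $V_i$ and on $V_{i+1}$, and $\mathrm{Sp}(P)$ is $2$-Cayley over its image. Moreover $G_0\cong G_1$; in particular every 2-partite Cayley graph is bi-Cayley. -/

import Mathlib

universe u v w

/-! ### Graphs with directed edges, automorphisms, `n`-Cayley graphs -/

/-- A graph with vertex set `V` and set of directed edges `E`: a fixed-point-free involution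
(edge reversal) and a terminus map. Loops and multiple edges are allowed. -/
structure DirGraph (V : Type u) (E : Type v) where
  inv : E → E
  inv_inv : ∀ e, inv (inv e) = e
  inv_ne : ∀ e, inv e ≠ e
  τ : E → V

namespace DirGraph

variable {V : Type u} {E : Type v}

/-- The automorphism group: pairs of bijections of the vertices and of the directed edges that
commute with reversal and with the terminus map. -/
def Aut (Γ : DirGraph V E) : Subgroup (Equiv.Perm V × Equiv.Perm E) where
  carrier := {f | (∀ e, f.2 (Γ.inv e) = Γ.inv (f.2 e)) ∧ ∀ e, f.1 (Γ.τ e) = Γ.τ (f.2 e)}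
  one_mem' := ⟨fun _ => rfl, fun _ => rfl⟩
  mul_mem' := by
    rintro f g ⟨hf, hf'⟩ ⟨hg, hg'⟩
    refine ⟨fun e => ?_, fun e => ?_⟩
    · simp [hf, hg]
    · simp [hf', hg']
  inv_mem' := by
    rintro f ⟨hf, hf'⟩
    refine ⟨fun e => ?_, fun e => ?_⟩
    · apply f.2.injective
      rw [hf]
      simp
    · apply f.1.injective
      rw [hf']
      simp

/-- Automorphisms act on the vertices. -/
instance (Γ : DirGraph V E) : MulAction Γ.Aut V where
  smul f x := f.1.1 x
  one_smul _ := rfl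
  mul_smul _ _ _ := rfl

/-- The group of automorphisms preserving a colouring `c` of the directed edges. -/
def AutCol {C : Type w} (Γ : DirGraph V E) (c : E → C) : Subgroup Γ.Aut where
  carrier := {f | ∀ e, c (f.1.2 e) = c e}
  one_mem' := fun _ => rfl
  mul_mem' := by
    intro f g hf hg e
    exact (hf (g.1.2 e)).trans (hg e)
  inv_mem' := by
    intro f hf e
    have h : c (f.1.2 (f.1.2⁻¹ e)) = c (f.1.2⁻¹ e) := hf _
    have h' : f.1.2 (f.1.2⁻¹ e) = e := by simp
    rw [h'] at h
    exact h.symm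

/-- `Γ` is `n`-Cayley over the group `H` of automorphisms: `H` acts semi-regularly (freely) on the
vertices, with exactly `n` orbits. -/
def IsNCayleyOver (Γ : DirGraph V E) (H : Subgroup Γ.Aut) (n : Cardinal.{w}) : Prop :=
  (∀ g ∈ H, ∀ h ∈ H, ∀ x : V, g • x = h • x → g = h) ∧
    Cardinal.lift.{w} (Cardinal.mk (MulAction.orbitRel.Quotient H V)) = Cardinal.lift.{u} n

/-- `Γ` is `n`-Cayley. -/
def IsNCayley (Γ : DirGraph V E) (n : Cardinal.{w}) : Prop :=
  ∃ H : Subgroup Γ.Aut, Γ.IsNCayleyOver H n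

/-- `Γ` is bi-Cayley. -/
def IsBiCayley (Γ : DirGraph V E) : Prop := Γ.IsNCayley (2 : Cardinal.{0})

end DirGraph

/-- The action of `G` on `V` restricts to a regular (free and transitive) action on the non-empty
subset `A`. -/
def ActsRegularlyOn (G : Type u) [Group G] {V : Type v} [MulAction G V] (A : Set V) : Prop :=
  A.Nonempty ∧ (∀ g : G, ∀ x ∈ A, g • x ∈ A) ∧ ∀ x ∈ A, ∀ y ∈ A, ∃! g : G, g • x = y

/-! ### The group `MF = ⟨U ∪ I | s² (s ∈ I)⟩`, its tree, and coloured quotients of the tree -/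

/-- The free product of an infinite cyclic group for each `s ∈ U` and a group of order two for
each `s ∈ I`, given by the presentation `⟨U ⊔ I | s² (s ∈ I)⟩`. -/
abbrev MF (U : Type v) (I : Type w) : Type (max v w) :=
  PresentedGroup {r : FreeGroup (U ⊕ I) | ∃ i : I, r = FreeGroup.of (Sum.inr i) ^ 2}

namespace MF

variable {U : Type v} {I : Type w}

/-- The generator `s` as an element of `MF`. -/
def gen (s : U ⊕ I) : MF U I := PresentedGroup.of s

/-- The homomorphism out of `MF` given by the images of the generators. -/
def lift {G : Type u} [Group G] (f : U ⊕ I → G) (hf : ∀ i, f (Sum.inr i) ^ 2 = 1) : MF U I →* G :=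
  PresentedGroup.toGroup (f := f) (by rintro r ⟨i, rfl⟩; simp [hf i])

theorem lift_gen {G : Type u} [Group G] (f : U ⊕ I → G) (hf : ∀ i, f (Sum.inr i) ^ 2 = 1)
    (s : U ⊕ I) : lift f hf (gen s) = f s :=
  PresentedGroup.toGroup.of _

theorem gen_inl_sq_ne (a : U) : gen (Sum.inl a : U ⊕ I) ^ 2 ≠ 1 := by
  intro h
  let F : MF U I →* Multiplicative ℤ :=
    lift (Sum.elim (fun _ => Multiplicative.ofAdd 1) (fun _ => 1)) (by simp)
  have hF : F (gen (Sum.inl a)) = Multiplicative.ofAdd 1 := lift_gen _ _ _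
  have h' := congrArg F h
  rw [map_pow, hF, F.map_one] at h'
  exact absurd h' (by decide)

theorem gen_ne_one (s : U ⊕ I) : gen s ≠ 1 := by
  rcases s with a | i
  · intro h
    exact gen_inl_sq_ne (I := I) a (by rw [h, one_pow])
  · intro h
    let F : MF U I →* Multiplicative (ZMod 2) :=
      lift (Sum.elim (fun _ => 1) (fun _ => Multiplicative.ofAdd 1)) (fun _ => by
        simp only [Sum.elim_inr]; decide)
    have hF : F (gen (Sum.inr i)) = Multiplicative.ofAdd 1 := lift_gen _ _ _
    have h' := congrArg F h
    rw [hF, F.map_one] at h'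
    exact absurd h' (by decide)

/-- The subset `S ∪ S⁻¹` of `MF`, where `S` is the set of generators; these are the colours. -/
def Letter (U : Type v) (I : Type w) : Type (max v w) :=
  {g : MF U I // ∃ s : U ⊕ I, g = gen s ∨ g = (gen s)⁻¹}

/-- Inversion of letters. -/
def Letter.inv (s : Letter U I) : Letter U I :=
  ⟨s.1⁻¹, by
    obtain ⟨t, h | h⟩ := s.2
    · exact ⟨t, Or.inr (by rw [h])⟩
    · exact ⟨t, Or.inl (by rw [h, inv_inv])⟩⟩

theorem Letter.ne_one (s : Letter U I) : s.1 ≠ 1 := by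
  obtain ⟨t, h | h⟩ := s.2
  · rw [h]; exact gen_ne_one t
  · rw [h]; exact inv_ne_one.2 (gen_ne_one t)

/-- The tree with vertex set `MF` and directed edges `(w, ws)` for `w ∈ MF`, `s ∈ S ∪ S⁻¹`. The
edge `(w, ws)` is recorded as the pair of `w` and `s`. -/
def tree (U : Type v) (I : Type w) : DirGraph (MF U I) (MF U I × Letter U I) where
  inv e := (e.1 * e.2.1, e.2.inv)
  inv_inv e := by
    refine Prod.ext ?_ (Subtype.ext ?_)
    · exact mul_inv_cancel_right _ _
    · exact inv_inv _
  inv_ne e h := e.2.ne_one (mul_eq_left.1 (congrArg Prod.fst h))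
  τ e := e.1 * e.2.1

/-- The colouring `c(w, ws) = s` of the tree. -/
def treeColour (e : MF U I × Letter U I) : Letter U I := e.2

/-- Extension of an equivalence relation on the vertices of the tree to its edges: two edges are
equivalent if they have the same colour and equivalent end-vertices. -/
def edgeSetoid (r : Setoid (MF U I)) : Setoid (MF U I × Letter U I) where
  r e f := treeColour e = treeColour f ∧ r ((tree U I).τ e) ((tree U I).τ f) ∧
    r ((tree U I).τ ((tree U I).inv e)) ((tree U I).τ ((tree U I).inv f))
  iseqv :=
    { refl := fun _ => ⟨rfl, r.refl _, r.refl _⟩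
      symm := fun h => ⟨h.1.symm, r.symm h.2.1, r.symm h.2.2⟩
      trans := fun h k => ⟨h.1.trans k.1, r.trans h.2.1 k.2.1, r.trans h.2.2 k.2.2⟩ }

/-- The quotient of the tree by an equivalence relation that never identifies the two ends of an
edge coloured by an element of `I` (so that no edge is identified with its reverse). -/
def quotGraph (r : Setoid (MF U I)) (hr : ∀ (i : I) (x : MF U I), ¬ r x (x * gen (Sum.inr i))) :
    DirGraph (Quotient r) (Quotient (edgeSetoid r)) where
  inv := Quotient.map (tree U I).inv (by
    rintro e f ⟨h1, h2, h3⟩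
    refine ⟨congrArg Letter.inv h1, h3, ?_⟩
    rw [(tree U I).inv_inv, (tree U I).inv_inv]
    exact h2)
  inv_inv e := by
    induction e using Quotient.inductionOn with
    | h e => simp [Quotient.map_mk, (tree U I).inv_inv]
  inv_ne e := by
    induction e using Quotient.inductionOn with
    | h e =>
      intro h
      obtain ⟨h1, h2, h3⟩ := Quotient.exact h
      obtain ⟨x, s⟩ := e
      have h1 : s.1⁻¹ = s.1 := congrArg Subtype.val h1
      have h3 : r (x * s.1 * s.1⁻¹) (x * s.1) := by
        rw [(tree U I).inv_inv] at h3
        exact r.symm (by simpa [tree, Letter.inv] using h3)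
      rw [mul_inv_cancel_right] at h3
      have hs : ∃ t : U ⊕ I, s.1 = gen t := by
        obtain ⟨t, ht | ht⟩ := s.2
        · exact ⟨t, ht⟩
        · exact ⟨t, by rw [← h1, ht, inv_inv]⟩
      obtain ⟨t, ht⟩ := hs
      rw [ht] at h1 h3
      rcases t with a | i
      · exact gen_inl_sq_ne (I := I) a (by rw [sq]; nth_rewrite 1 [← h1]; simp)
      · exact hr i x h3
  τ := Quotient.map (tree U I).τ (fun _ _ h => h.2.1)

/-- The colouring of the quotient graph induced by the colouring of the tree. -/
def quotColour (r : Setoid (MF U I)) : Quotient (edgeSetoid r) → Letter U I :=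
  Quotient.lift treeColour (fun _ _ h => h.1)

end MF

/-! ### Partite presentations -/

/-- The right action of `MF` on `X` given by a map from the generators to the permutations of `X`:
`x · (s₁ ⋯ sₙ) = φ(sₙ) (⋯ (φ(s₁) x))`. -/
def rightAct {X : Type u} {U : Type v} {I : Type w} (φ : U ⊕ I → Equiv.Perm X)
    (hφ : ∀ i, φ (Sum.inr i) ^ 2 = 1) : MF U I →* (Equiv.Perm X)ᵐᵒᵖ :=
  MF.lift (fun s => MulOpposite.op (φ s)) (fun i => by
    rw [← MulOpposite.op_pow, hφ i, MulOpposite.op_one])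

/-- A partite presentation `⟨X | U | I | φ | R⟩`. -/
structure PartitePresentation (X : Type u) (U : Type v) (I : Type w) where
  φ : U ⊕ I → Equiv.Perm X
  /-- for `s ∈ I`, the permutation `φ s` is an involution ... -/
  φ_sq : ∀ i, φ (Sum.inr i) ^ 2 = 1
  /-- ... without fixed points -/
  φ_ne : ∀ i x, φ (Sum.inr i) x ≠ x
  /-- the action on `X` is transitive -/
  transitive : ∀ x y : X, ∃ g : MF U I, (rightAct φ φ_sq g).unop x = y
  /-- the relator sets, -/
  rel : X → Set (MF U I)
  /-- which consist of elements of the stabilisers -/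
  rel_stab : ∀ x, ∀ r ∈ rel x, (rightAct φ φ_sq r).unop x = x

namespace PartitePresentation

variable {X : Type u} {U : Type v} {I : Type w} (P : PartitePresentation X U I)

/-- `P.act x g` is the vertex class `x · g` reached from `x` along the word `g`. -/
def act (x : X) (g : MF U I) : X := (rightAct P.φ P.φ_sq g).unop x

theorem act_one (x : X) : P.act x 1 = x := by simp [act]

theorem act_mul (x : X) (g h : MF U I) : P.act x (g * h) = P.act (P.act x g) h := by
  simp [act]

theorem act_gen (x : X) (s : U ⊕ I) : P.act x (MF.gen s) = P.φ s x := by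
  simp [act, rightAct, MF.lift_gen]

theorem act_inv {x y : X} {g : MF U I} (h : P.act x g = y) : P.act y g⁻¹ = x := by
  rw [← h, ← act_mul, mul_inv_cancel, act_one]

/-- `W x y` is the set of words leading from the class `x` to the class `y`. -/
def W (x y : X) : Set (MF U I) := {g | P.act x g = y}

/-- The stabiliser `W x x` of the class `x`. -/
def stab (x : X) : Subgroup (MF U I) where
  carrier := P.W x x
  one_mem' := P.act_one x
  mul_mem' := by
    intro g h (hg : P.act x g = x) (hh : P.act x h = x)
    change P.act x (g * h) = x
    rw [act_mul, hg, hh]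
  inv_mem' := fun h => P.act_inv h

/-- `R_x = ⟨g r g⁻¹ | y ∈ X, g ∈ W x y, r ∈ rel y⟩`. -/
def relSub (x : X) : Subgroup (MF U I) :=
  Subgroup.closure {k | ∃ y, ∃ g ∈ P.W x y, ∃ r ∈ P.rel y, k = g * r * g⁻¹}

theorem relSub_le (x : X) : P.relSub x ≤ P.stab x := by
  refine (Subgroup.closure_le _).2 ?_
  rintro k ⟨y, g, hg, r, hr, rfl⟩
  change P.act x (g * r * g⁻¹) = x
  have hg : P.act x g = y := hg
  have hr : P.act y r = y := P.rel_stab y r hr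
  rw [act_mul, act_mul, hg, hr, P.act_inv hg]

theorem conj_mem_relSub {x y : X} {g k : MF U I} (hg : P.act x g = y) (hk : k ∈ P.relSub y) :
    g * k * g⁻¹ ∈ P.relSub x := by
  have h : P.relSub y ≤ (P.relSub x).comap (MulAut.conj g).toMonoidHom := by
    refine (Subgroup.closure_le _).2 ?_
    rintro k ⟨z, a, ha, r, hr, rfl⟩
    have ha : P.act y a = z := ha
    refine Subgroup.subset_closure ⟨z, g * a, ?_, r, hr, ?_⟩
    · change P.act x (g * a) = z
      rw [act_mul, hg, ha]
    · simp [mul_assoc]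
  exact h hk

instance (x : X) : ((P.relSub x).subgroupOf (P.stab x)).Normal where
  conj_mem _ hk g := P.conj_mem_relSub g.2 hk

/-- The vertex group `G_x = W x x / R_x`. -/
abbrev VertexGroup (x : X) : Type (max v w) := P.stab x ⧸ (P.relSub x).subgroupOf (P.stab x)

/-- The class `Ṽ_x = W b x` of vertices of the tree, for the base class `b`. -/
def treeClass (b x : X) : Set (MF U I) := P.W b x

/-- The equivalence relation on the vertices of the tree: `g ∼ h` if `g` and `h` lie in the same
class `Ṽ_x` and `g⁻¹ h ∈ R_x`. -/
def vertexSetoid (b : X) : Setoid (MF U I) where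
  r g h := ∃ x, g ∈ P.treeClass b x ∧ h ∈ P.treeClass b x ∧ g⁻¹ * h ∈ P.relSub x
  iseqv :=
    { refl := fun g => ⟨P.act b g, rfl, rfl, by simp⟩
      symm := by
        rintro g h ⟨x, hg, hh, hk⟩
        refine ⟨x, hh, hg, ?_⟩
        have := inv_mem hk
        rwa [mul_inv_rev, inv_inv] at this
      trans := by
        rintro g h k ⟨x, hg, hh, h1⟩ ⟨y, hh', hk, h2⟩
        obtain rfl : x = y := Eq.trans (Eq.symm hh) hh'
        refine ⟨x, hg, hk, ?_⟩
        have := mul_mem h1 h2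
        rwa [mul_assoc, mul_inv_cancel_left] at this }

theorem not_rel_gen (b : X) (i : I) (g : MF U I) :
    ¬ P.vertexSetoid b g (g * MF.gen (Sum.inr i)) := by
  rintro ⟨x, hg, hh, -⟩
  have hg : P.act b g = x := hg
  have hh : P.act b (g * MF.gen (Sum.inr i)) = x := hh
  rw [act_mul, hg, act_gen] at hh
  exact P.φ_ne i x hh

/-- Vertices of the partite Cayley graph. -/
abbrev Vert (b : X) : Type (max v w) := Quotient (P.vertexSetoid b)

/-- Directed edges of the partite Cayley graph. -/
abbrev Edge (b : X) : Type (max v w) := Quotient (MF.edgeSetoid (P.vertexSetoid b))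

/-- The partite Cayley graph of `P` (with base class `b`). -/
def cayley (b : X) : DirGraph (P.Vert b) (P.Edge b) :=
  MF.quotGraph (P.vertexSetoid b) (P.not_rel_gen b)

/-- The colouring of the partite Cayley graph by `S ∪ S⁻¹`. -/
def colour (b : X) : P.Edge b → MF.Letter U I := MF.quotColour (P.vertexSetoid b)

/-- The vertex of the partite Cayley graph represented by `g`. -/
def vert (b : X) (g : MF U I) : P.Vert b := Quotient.mk _ g

/-- The vertex class `V_x` of the partite Cayley graph. -/
def vertexClass (b x : X) : Set (P.Vert b) := P.vert b '' P.treeClass b x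

end PartitePresentation

/-! ### 2-partite presentations -/

/-- The homomorphism from `MF` to `ℤ/2` that counts, modulo two, the letters from `U ∪ I`
(as opposed to `S₁`). -/
def twoDeg (S₁ : Type u) (U : Type v) (I : Type w) : MF (S₁ ⊕ U) I →* Multiplicative (ZMod 2) :=
  MF.lift (Sum.elim (Sum.elim (fun _ => 1) (fun _ => Multiplicative.ofAdd 1))
    (fun _ => Multiplicative.ofAdd 1)) (fun _ => by simp only [Sum.elim_inr]; decide)

/-- A 2-partite presentation `⟨S₁, U, I | R₀, R₁⟩`, with relator sets in the kernel `K`. -/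
structure TwoPartitePresentation (S₁ : Type u) (U : Type v) (I : Type w) where
  rel : ZMod 2 → Set (MF (S₁ ⊕ U) I)
  rel_ker : ∀ i, ∀ r ∈ rel i, r ∈ (twoDeg S₁ U I).ker

namespace TwoPartitePresentation

variable {S₁ : Type u} {U : Type v} {I : Type w} (P : TwoPartitePresentation S₁ U I)

/-- The kernel `K`. -/
abbrev K (_P : TwoPartitePresentation S₁ U I) : Subgroup (MF (S₁ ⊕ U) I) := (twoDeg S₁ U I).ker

/-- The generators in `S₂ = U ∪ I`, as elements of `MF`. -/
def gen₂ : U ⊕ I → MF (S₁ ⊕ U) I :=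
  Sum.elim (fun a => MF.gen (Sum.inl (Sum.inr a))) (fun i => MF.gen (Sum.inr i))

/-- `R_i` is the normal closure in `K` of `rel i ∪ {s r s⁻¹ | r ∈ rel (i + 1), s ∈ S₂}`. -/
def relSub (i : ZMod 2) : Subgroup P.K :=
  Subgroup.normalClosure
    {k | (k : MF (S₁ ⊕ U) I) ∈ P.rel i ∨
      ∃ r ∈ P.rel (i + 1), ∃ s : U ⊕ I, (k : MF (S₁ ⊕ U) I) = gen₂ s * r * (gen₂ s)⁻¹}

instance (i : ZMod 2) : (P.relSub i).Normal := Subgroup.normalClosure_normal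

/-- The vertex group `G_i = K / R_i`. -/
abbrev VertexGroup (i : ZMod 2) : Type (max u v w) := P.K ⧸ P.relSub i

/-- The coset `Ṽ_i` of `K`: `Ṽ_0 = K`, and `Ṽ_1` is its complement `S₂ K`. -/
def treeClass (_P : TwoPartitePresentation S₁ U I) (i : ZMod 2) : Set (MF (S₁ ⊕ U) I) :=
  {g | twoDeg S₁ U I g = Multiplicative.ofAdd i}

/-- The equivalence relation on the vertices of the tree: `g ∼ h` if `g` and `h` lie in the same
class `Ṽ_i` and `g⁻¹ h ∈ R_i`. -/
def vertexSetoid : Setoid (MF (S₁ ⊕ U) I) where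
  r g h := ∃ i, g ∈ P.treeClass i ∧ h ∈ P.treeClass i ∧ g⁻¹ * h ∈ (P.relSub i).map P.K.subtype
  iseqv :=
    { refl := fun g => ⟨Multiplicative.toAdd (twoDeg S₁ U I g), rfl, rfl, by
        rw [inv_mul_cancel]; exact one_mem _⟩
      symm := by
        rintro g h ⟨x, hg, hh, hk⟩
        refine ⟨x, hh, hg, ?_⟩
        have := inv_mem hk
        rwa [mul_inv_rev, inv_inv] at this
      trans := by
        rintro g h k ⟨x, hg, hh, h1⟩ ⟨y, hh', hk, h2⟩
        obtain rfl : x = y := Multiplicative.ofAdd.injective (Eq.trans (Eq.symm hh) hh')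
        refine ⟨x, hg, hk, ?_⟩
        have := mul_mem h1 h2
        rwa [mul_assoc, mul_inv_cancel_left] at this }

theorem not_rel_gen (i : I) (g : MF (S₁ ⊕ U) I) :
    ¬ P.vertexSetoid g (g * MF.gen (Sum.inr i)) := by
  rintro ⟨x, hg, hh, -⟩
  have hg : twoDeg S₁ U I g = Multiplicative.ofAdd x := hg
  have hh : twoDeg S₁ U I (g * MF.gen (Sum.inr i)) = Multiplicative.ofAdd x := hh
  rw [map_mul, hg, mul_eq_left, twoDeg, MF.lift_gen] at hh
  simp only [Sum.elim_inr] at hh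
  exact absurd hh (by decide)

/-- Vertices of the 2-partite Cayley graph. -/
abbrev Vert : Type (max u v w) := Quotient P.vertexSetoid

/-- Directed edges of the 2-partite Cayley graph. -/
abbrev Edge : Type (max u v w) := Quotient (MF.edgeSetoid P.vertexSetoid)

/-- The 2-partite Cayley graph of `P`. -/
def cayley : DirGraph P.Vert P.Edge := MF.quotGraph P.vertexSetoid P.not_rel_gen

/-- The colouring of the 2-partite Cayley graph by `S ∪ S⁻¹`. -/
def colour : P.Edge → MF.Letter (S₁ ⊕ U) I := MF.quotColour P.vertexSetoid

/-- The vertex of the 2-partite Cayley graph represented by `g`. -/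
def vert (g : MF (S₁ ⊕ U) I) : P.Vert := Quotient.mk _ g

/-- The vertex class `V_i` of the 2-partite Cayley graph. -/
def vertexClass (i : ZMod 2) : Set P.Vert := P.vert '' P.treeClass i

end TwoPartitePresentation

/-! The edges of the tree are right multiplications by letters, so left translations preserve it
with its colours. The elements `p g p⁻¹`, with `g` in the stabiliser of `x` (respectively in `K`),
form the stabiliser of `b` (respectively `K`), whose orbits under left translation are exactly the
classes `Ṽ_y`. Such translations preserve `∼`, because `g⁻¹ h` does not change when `g` and `h` are
both translated on the left.

The point is that all vertices of the quotient have the same stabiliser. The translation by `p g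
p⁻¹` fixes `[h]` exactly when `(h⁻¹ p) g⁻¹ (h⁻¹ p)⁻¹` lies in the relator subgroup `R_y` of the
class `y` of `h`. Conjugation by a word leading from `y` to `x` carries `R_x` onto `R_y`, so the
condition is `g ∈ R_x`, whatever `h` is. Hence the vertex group acts freely, and its orbits are the
classes.

`MF.exists_regular_action` turns this into the conclusion for any such family of translations. The
two versions of `conj_mem_relSub_iff` supply the conjugation property; in the 2-partite case it must
be derived from the definition of `R_i`, and it also gives `G_0 ≅ G_1`. -/

namespace MF

variable {U : Type v} {I : Type w} {S : Type*} [Group S]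

/-! ### Left translations on coloured quotients of the tree -/

section translate

variable (r : Setoid (MF U I)) (θ : S →* MF U I)
  (hθ : ∀ g h h', r h h' → r (θ g * h) (θ g * h'))

/-- A group acting on the tree by left translations that preserve the equivalence relation `r`
acts on the vertices of the quotient. -/
def translateVert : S →* Equiv.Perm (Quotient r) :=
  MonoidHom.toHomPerm
    { toFun := fun g => Quotient.map (θ g * ·) (fun h h' => hθ g h h')
      map_one' := by
        refine funext fun q => ?_
        induction q using Quotient.inductionOn with
        | h a => simp [Quotient.map_mk, Function.End.one_def]
      map_mul' := fun g g' => by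
        refine funext fun q => ?_
        induction q using Quotient.inductionOn with
        | h a => simp only [Quotient.map_mk, map_mul, mul_assoc]; rfl }

/-- A group acting on the tree by left translations that preserve the equivalence relation `r`
acts on the edges of the quotient. -/
def translateEdge : S →* Equiv.Perm (Quotient (edgeSetoid r)) :=
  MonoidHom.toHomPerm
    { toFun := fun g => Quotient.map (fun e => (θ g * e.1, e.2)) (by
        rintro ⟨a, s⟩ ⟨b, t⟩ ⟨h1, h2, h3⟩
        refine ⟨h1, ?_, ?_⟩
        · simpa [tree, mul_assoc] using hθ g _ _ h2
        · simpa [tree, mul_assoc] using hθ g _ _ h3)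
      map_one' := by
        refine funext fun q => ?_
        induction q using Quotient.inductionOn with
        | h a => simp [Quotient.map_mk, Function.End.one_def]
      map_mul' := fun g g' => by
        refine funext fun q => ?_
        induction q using Quotient.inductionOn with
        | h a => simp only [Quotient.map_mk, map_mul, mul_assoc]; rfl }

variable (hr : ∀ (i : I) (x : MF U I), ¬ r x (x * gen (Sum.inr i)))

/-- The action by left translations on a quotient of the tree, as a homomorphism to the group of
colour-preserving automorphisms. -/
def translate : S →* (quotGraph r hr).AutCol (quotColour r) :=
  (((translateVert r θ hθ).prod (translateEdge r θ hθ)).codRestrict (quotGraph r hr).Aut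
    (fun g => by
      refine ⟨fun e => ?_, fun e => ?_⟩
      · induction e using Quotient.inductionOn with
        | h e =>
          refine congrArg (Quotient.mk (edgeSetoid r)) (Prod.ext ?_ rfl)
          simp [tree, mul_assoc]
      · induction e using Quotient.inductionOn with
        | h e =>
          refine congrArg (Quotient.mk r) ?_
          simp [tree, mul_assoc])).codRestrict _
    (fun g e => by
      induction e using Quotient.inductionOn with
      | h e => rfl)

/-- An edge of the quotient is determined by its colour and its end-vertices, so a translation that
fixes every vertex also fixes every edge. -/
theorem translate_eq_one {g : S} (hg : ∀ h, r (θ g * h) h) : translate r θ hθ hr g = 1 := by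
  refine Subtype.ext (Subtype.ext (Prod.ext (Equiv.ext fun q => ?_) (Equiv.ext fun q => ?_)))
  · induction q using Quotient.inductionOn with
    | h a => exact Quotient.sound (hg a)
  · induction q using Quotient.inductionOn with
    | h e =>
      refine Quotient.sound ⟨rfl, ?_, ?_⟩
      · simpa [tree, mul_assoc] using hg (e.1 * e.2.1)
      · simpa [tree, Letter.inv] using hg e.1

end translate

/-- If a group acts on the tree by left translations that preserve `r`, the elements moving some
vertex within its class being those of a normal subgroup `N`, and the orbits on the tree being the
fibres of a map `cls`, then the quotient by `N` acts on the quotient graph, regularly on the image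
of each fibre. -/
theorem exists_regular_action (r : Setoid (MF U I))
    (hr : ∀ (i : I) (x : MF U I), ¬ r x (x * gen (Sum.inr i)))
    {X : Type u} (cls : MF U I → X) (hcls : Function.Surjective cls)
    (hrcls : ∀ h h', r h h' → cls h = cls h')
    (N : Subgroup S) [N.Normal] (θ : S →* MF U I)
    (hθ : ∀ g h h', r h h' → r (θ g * h) (θ g * h'))
    (hfree : ∀ g h, r (θ g * h) h ↔ g ∈ N)
    (htrans : ∀ h h', cls h = cls h' ↔ ∃ g, θ g * h = h') :
    ∃ ι : S ⧸ N →* (quotGraph r hr).AutCol (quotColour r),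
      Function.Injective ι ∧
      (∀ (g : S) (h : MF U I),
        (ι (QuotientGroup.mk g)).1 • (Quotient.mk r h : Quotient r) = Quotient.mk r (θ g * h)) ∧
      (∀ y : X, ActsRegularlyOn
        (ι.range.map ((quotGraph r hr).AutCol (quotColour r)).subtype)
        (Quotient.mk r '' {h | cls h = y})) ∧
      (quotGraph r hr).IsNCayleyOver
        (ι.range.map ((quotGraph r hr).AutCol (quotColour r)).subtype) (Cardinal.mk X) := by
  let ι : S ⧸ N →* (quotGraph r hr).AutCol (quotColour r) :=
    QuotientGroup.lift N (translate r θ hθ hr)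
      (fun g hg => translate_eq_one r θ hθ hr fun h => (hfree g h).2 hg)
  have hι : ∀ (g : S) (h : MF U I),
      (ι (QuotientGroup.mk g)).1 • (Quotient.mk r h : Quotient r) = Quotient.mk r (θ g * h) :=
    fun _ _ => rfl
  -- equality on a single vertex already forces equality
  have hsemi : ∀ (a b : S ⧸ N) (q : Quotient r), (ι a).1 • q = (ι b).1 • q → a = b := by
    intro a b q
    induction a using QuotientGroup.induction_on with
    | H a =>
    induction b using QuotientGroup.induction_on with
    | H b =>
    induction q using Quotient.inductionOn with
    | h h =>
    intro hab
    rw [hι, hι] at hab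
    -- Translating `θ b * h ∼ θ a * h` by `θ a⁻¹` shows that `a⁻¹ * b` fixes the class of `h`, so it
    -- lies in `N`.
    refine (QuotientGroup.eq.2 ((hfree _ h).1 ?_))
    have := hθ a⁻¹ _ _ (r.symm (Quotient.exact hab))
    simpa [mul_assoc] using this
  let H := ι.range.map ((quotGraph r hr).AutCol (quotColour r)).subtype
  have hH : ∀ f : (quotGraph r hr).Aut, f ∈ H ↔ ∃ g : S, (ι (QuotientGroup.mk g)).1 = f := by
    intro f
    constructor
    · rintro ⟨_, ⟨a, rfl⟩, rfl⟩
      obtain ⟨g, rfl⟩ := QuotientGroup.mk_surjective a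
      exact ⟨g, rfl⟩
    · rintro ⟨g, rfl⟩
      exact ⟨_, ⟨QuotientGroup.mk g, rfl⟩, rfl⟩
  have hHfree : ∀ f ∈ H, ∀ f' ∈ H, ∀ q : Quotient r, f • q = f' • q → f = f' := by
    intro f hf f' hf' q hq
    obtain ⟨g, rfl⟩ := (hH f).1 hf
    obtain ⟨g', rfl⟩ := (hH f').1 hf'
    rw [hsemi _ _ q hq]
  have hclsθ : ∀ g h, cls (θ g * h) = cls h := fun g h => ((htrans _ _).2 ⟨g, rfl⟩).symm
  refine ⟨ι, fun a b hab => hsemi a b (Quotient.mk r 1) (by rw [hab]), hι, fun y => ?_, hHfree, ?_⟩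
  · refine ⟨?_, ?_, ?_⟩
    · obtain ⟨h, hh⟩ := hcls y
      exact ⟨_, h, hh, rfl⟩
    · rintro ⟨f, hf⟩ _ ⟨h, hh, rfl⟩
      obtain ⟨g, rfl⟩ := (hH f).1 hf
      exact ⟨θ g * h, (hclsθ g h).trans hh, rfl⟩
    · rintro _ ⟨h, hh, rfl⟩ _ ⟨h', hh', rfl⟩
      obtain ⟨g, hg⟩ := (htrans h h').1 (Eq.trans hh (Eq.symm hh'))
      refine ⟨⟨_, (hH _).2 ⟨g, rfl⟩⟩, congrArg (Quotient.mk r) hg, ?_⟩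
      rintro ⟨f, hf⟩ hfh
      refine Subtype.ext (hHfree f hf _ ((hH _).2 ⟨g, rfl⟩) (Quotient.mk r h) ?_)
      exact Eq.trans hfh (congrArg (Quotient.mk r) hg.symm)
  -- The map `cls` descends to the quotient graph and is constant on orbits there; `htrans` makes
  -- the induced map on orbits injective, so there are `#X` of them.
  · let F : MulAction.orbitRel.Quotient H (Quotient r) → X :=
      Quotient.lift (Quotient.lift cls hrcls) (by
        rintro _ q ⟨⟨f, hf⟩, rfl⟩
        obtain ⟨g, rfl⟩ := (hH f).1 hf
        induction q using Quotient.inductionOn with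
        | h h => exact hclsθ g h)
    have hF : Function.Bijective F := by
      constructor
      · intro q q' hq
        induction q using Quotient.inductionOn with
        | h q =>
        induction q' using Quotient.inductionOn with
        | h q' =>
        induction q using Quotient.inductionOn with
        | h h =>
        induction q' using Quotient.inductionOn with
        | h h' =>
        obtain ⟨g, hg⟩ := (htrans h' h).1 (Eq.symm hq)
        exact Quotient.sound ⟨⟨_, (hH _).2 ⟨g, rfl⟩⟩, congrArg (Quotient.mk r) hg⟩
      · intro y
        obtain ⟨h, hh⟩ := hcls y
        exact ⟨Quotient.mk _ (Quotient.mk r h), hh⟩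
    exact Cardinal.mk_congr_lift (Equiv.ofBijective F hF)

end MF

/-! ### Partite presentations -/

namespace PartitePresentation

variable {X : Type u} {U : Type v} {I : Type w} (P : PartitePresentation X U I)

/-- The inverse word leads back from `y` to `x`, so the one-sided inclusion applies in both
directions. -/
theorem conj_mem_relSub_iff {x y : X} {g k : MF U I} (hg : P.act x g = y) :
    g * k * g⁻¹ ∈ P.relSub x ↔ k ∈ P.relSub y := by
  refine ⟨fun h => ?_, P.conj_mem_relSub hg⟩
  have := P.conj_mem_relSub (P.act_inv hg) h
  simpa [mul_assoc] using this

theorem vertexSetoid_iff (b : X) (g h : MF U I) :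
    P.vertexSetoid b g h ↔ P.act b g = P.act b h ∧ g⁻¹ * h ∈ P.relSub (P.act b h) := by
  constructor
  · rintro ⟨x, hg, hh, hk⟩
    have hg : P.act b g = x := hg
    have hh : P.act b h = x := hh
    exact ⟨hg.trans hh.symm, by rwa [hh]⟩
  · rintro ⟨h1, h2⟩
    exact ⟨_, h1, rfl, h2⟩

theorem exists_vertexGroup_action (b x : X) (p : MF U I) (hp : p ∈ P.treeClass b x) :
    ∃ ι : P.VertexGroup x →* (P.cayley b).AutCol (P.colour b),
      Function.Injective ι ∧
      (∀ (g : P.stab x) (h : MF U I),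
        (ι (QuotientGroup.mk g)).1 • P.vert b h = P.vert b (p * g * p⁻¹ * h)) ∧
      (∀ y : X, ActsRegularlyOn
        (ι.range.map ((P.cayley b).AutCol (P.colour b)).subtype) (P.vertexClass b y)) ∧
      (P.cayley b).IsNCayleyOver
        (ι.range.map ((P.cayley b).AutCol (P.colour b)).subtype) (Cardinal.mk X) := by
  have hp : P.act b p = x := hp
  have hθ : ∀ (g : P.stab x), P.act b (p * g * p⁻¹) = b := fun g => by
    have hg : P.act x g = x := g.2
    rw [act_mul, act_mul, hp, hg, P.act_inv hp]
  refine MF.exists_regular_action (P.vertexSetoid b) (P.not_rel_gen b) (P.act b)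
    (P.transitive b) (fun h h' hh => ((P.vertexSetoid_iff b h h').1 hh).1)
    ((P.relSub x).subgroupOf (P.stab x))
    ((MulAut.conj p).toMonoidHom.comp (P.stab x).subtype) ?_ ?_ ?_
  · intro g h h' hh
    rw [vertexSetoid_iff] at hh ⊢
    simp only [MonoidHom.comp_apply, Subgroup.coe_subtype, MulEquiv.coe_toMonoidHom,
      MulAut.conj_apply]
    rw [act_mul, act_mul P b _ h', hθ]
    refine ⟨hh.1, ?_⟩
    simpa [mul_assoc] using hh.2
  · intro g h
    rw [vertexSetoid_iff]
    simp only [MonoidHom.comp_apply, Subgroup.coe_subtype, MulEquiv.coe_toMonoidHom,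
      MulAut.conj_apply]
    -- The word `h⁻¹ * p` leads from the class of `h` back to `b` and on to `x`. The inverse of `g`
    -- appears because `(p g p⁻¹ h)⁻¹ h = (h⁻¹ p) g⁻¹ (h⁻¹ p)⁻¹`.
    have hconj := P.conj_mem_relSub_iff (x := P.act b h) (y := x) (g := h⁻¹ * p)
      (k := (g : MF U I)⁻¹) (by rw [act_mul, P.act_inv rfl, hp])
    rw [inv_mem_iff] at hconj
    rw [act_mul, hθ, Subgroup.mem_subgroupOf, ← hconj]
    simp [mul_assoc]
  · intro h h'
    constructor
    · intro hh
      -- The only candidate: solve `p g p⁻¹ h = h'` for `g`.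
      refine ⟨⟨p⁻¹ * (h' * h⁻¹) * p, ?_⟩, by simp [mul_assoc]⟩
      change P.act x _ = x
      rw [act_mul, act_mul, act_mul, P.act_inv hp, ← hh, P.act_inv rfl, hp]
    · rintro ⟨g, rfl⟩
      simp only [MonoidHom.comp_apply, Subgroup.coe_subtype, MulEquiv.coe_toMonoidHom,
        MulAut.conj_apply]
      rw [act_mul, hθ]

end PartitePresentation

/-! ### 2-partite presentations -/

namespace TwoPartitePresentation

variable {S₁ : Type u} {U : Type v} {I : Type w} (P : TwoPartitePresentation S₁ U I)

theorem twoDeg_gen₂ (s : U ⊕ I) :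
    twoDeg S₁ U I (gen₂ s) = Multiplicative.ofAdd 1 := by
  rcases s with a | i <;> simp [gen₂, twoDeg, MF.lift_gen]

/-- The pullback of `R_{i+1}` under this conjugation is normal in `K`, so it suffices to treat the
two kinds of generators of `R_i`. -/
theorem conj_gen₂_mem_relSub (s : U ⊕ I) (i : ZMod 2) {k : P.K} (hk : k ∈ P.relSub i) :
    MulAut.conjNormal (gen₂ s) k ∈ P.relSub (i + 1) := by
  have h : P.relSub i ≤
      (P.relSub (i + 1)).comap (MulAut.conjNormal (H := P.K) (gen₂ s)).toMonoidHom := by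
    refine Subgroup.normalClosure_le_normal ?_
    rintro k (hk | ⟨r, hr, t, hk⟩)
    -- A relator of index `i = (i + 1) + 1` becomes a generator of the second kind for `R_{i+1}`.
    · refine Subgroup.subset_normalClosure (Or.inr ⟨k, ?_, s, ?_⟩)
      · rwa [add_assoc, CharTwo.add_self_eq_zero, add_zero]
      · simp
    -- A generator `t r t⁻¹` becomes `(s t) r (s t)⁻¹`, a conjugate under `K` of a relator of index
    -- `i + 1`.
    · have hst : gen₂ s * gen₂ t ∈ P.K := by
        rw [MonoidHom.mem_ker, map_mul, twoDeg_gen₂, twoDeg_gen₂]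
        decide
      have := (inferInstance : (P.relSub (i + 1)).Normal).conj_mem ⟨r, P.rel_ker _ r hr⟩
        (Subgroup.subset_normalClosure (Or.inl hr)) ⟨_, hst⟩
      refine (congrArg (· ∈ P.relSub (i + 1)) (Subtype.ext ?_)).mp this
      simp [hk, mul_assoc]
  exact h hk

/-- A word of even degree lies in `K`, which normalises each `R_l`. A word `g` of odd degree factors
as `(g s⁻¹) s` with `g s⁻¹ ∈ K`, which reduces it to conjugation by one generator `s` of `S₂`. -/
theorem conj_mem_relSub [hne : Nonempty (U ⊕ I)] {i j : ZMod 2} {g : MF (S₁ ⊕ U) I}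
    (hg : twoDeg S₁ U I g = Multiplicative.ofAdd (i - j)) {k : P.K} (hk : k ∈ P.relSub j) :
    MulAut.conjNormal g k ∈ P.relSub i := by
  have hK : ∀ (a : P.K) (l : ZMod 2) {k : P.K}, k ∈ P.relSub l →
      MulAut.conjNormal (a : MF (S₁ ⊕ U) I) k ∈ P.relSub l := by
    intro a l k hk
    rw [MulAut.conjNormal_val]
    exact (inferInstance : (P.relSub l).Normal).conj_mem k hk a
  have hcases : i = j ∨ i = j + 1 := by
    clear hg hk
    revert i j
    decide
  rcases hcases with rfl | rfl
  · exact hK ⟨g, by rw [MonoidHom.mem_ker, hg, sub_self]; rfl⟩ i hk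
  · obtain ⟨s⟩ := hne
    have ha : g * (gen₂ s)⁻¹ ∈ P.K := by
      rw [MonoidHom.mem_ker, map_mul, map_inv, hg, twoDeg_gen₂, add_sub_cancel_left,
        mul_inv_cancel]
    have := hK ⟨_, ha⟩ (j + 1) (P.conj_gen₂_mem_relSub s j hk)
    rw [← MulAut.mul_apply, ← map_mul] at this
    simpa using this

theorem conj_mem_relSub_iff [Nonempty (U ⊕ I)] {i j : ZMod 2} {g : MF (S₁ ⊕ U) I}
    (hg : twoDeg S₁ U I g = Multiplicative.ofAdd (i - j)) {k : P.K} :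
    MulAut.conjNormal g k ∈ P.relSub i ↔ k ∈ P.relSub j := by
  refine ⟨fun h => ?_, P.conj_mem_relSub hg⟩
  have := P.conj_mem_relSub (i := j) (j := i) (g := g⁻¹)
    (by rw [map_inv, hg, ← ofAdd_neg, neg_sub]) h
  rwa [← MulAut.mul_apply, ← map_mul, inv_mul_cancel, map_one] at this

theorem vertexSetoid_iff (g h : MF (S₁ ⊕ U) I) :
    P.vertexSetoid g h ↔ twoDeg S₁ U I g = twoDeg S₁ U I h ∧
      g⁻¹ * h ∈ (P.relSub (twoDeg S₁ U I h).toAdd).map P.K.subtype := by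
  constructor
  · rintro ⟨x, hg, hh, hk⟩
    have hg : twoDeg S₁ U I g = Multiplicative.ofAdd x := hg
    have hh : twoDeg S₁ U I h = Multiplicative.ofAdd x := hh
    exact ⟨hg.trans hh.symm, by rwa [hh]⟩
  · rintro ⟨h1, h2⟩
    exact ⟨_, h1, rfl, h2⟩

theorem exists_vertexGroup_action [hne : Nonempty (U ⊕ I)] (i : ZMod 2) (p : MF (S₁ ⊕ U) I)
    (hp : p ∈ P.treeClass i) :
    ∃ ι : P.VertexGroup i →* P.cayley.AutCol P.colour,
      Function.Injective ι ∧
      (∀ (g : P.K) (h : MF (S₁ ⊕ U) I),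
        (ι (QuotientGroup.mk g)).1 • P.vert h = P.vert (p * g * p⁻¹ * h)) ∧
      (∀ j : ZMod 2, ActsRegularlyOn
        (ι.range.map (P.cayley.AutCol P.colour).subtype) (P.vertexClass j)) ∧
      P.cayley.IsNCayleyOver
        (ι.range.map (P.cayley.AutCol P.colour).subtype) (2 : Cardinal.{0}) := by
  have hp : twoDeg S₁ U I p = Multiplicative.ofAdd i := hp
  have hθ : ∀ g : P.K, twoDeg S₁ U I (p * g * p⁻¹) = 1 := fun g => by
    have hg : twoDeg S₁ U I g = 1 := g.2
    rw [map_mul, map_mul, hg, mul_one, map_inv, mul_inv_cancel]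
  -- A generator in `S₂` is what makes the odd class non-empty, so that there are two orbits and not
  -- one.
  have hsurj : Function.Surjective fun g => (twoDeg S₁ U I g).toAdd := by
    obtain ⟨s⟩ := hne
    intro j
    have hj : j = 0 ∨ j = 1 := by revert j; decide
    rcases hj with rfl | rfl
    · exact ⟨1, by simp⟩
    · exact ⟨gen₂ s, by simp [twoDeg_gen₂]⟩
  have hcard : Cardinal.mk (ZMod 2) = 2 := by simp [Cardinal.mk_fintype]
  rw [← hcard]
  refine MF.exists_regular_action P.vertexSetoid P.not_rel_gen
    (fun g => (twoDeg S₁ U I g).toAdd) hsurj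
    (fun h h' hh => congrArg _ ((P.vertexSetoid_iff h h').1 hh).1) (P.relSub i)
    ((MulAut.conj p).toMonoidHom.comp P.K.subtype) ?_ ?_ ?_
  · intro g h h' hh
    rw [vertexSetoid_iff] at hh ⊢
    simp only [MonoidHom.comp_apply, Subgroup.coe_subtype, MulEquiv.coe_toMonoidHom,
      MulAut.conj_apply]
    rw [map_mul, map_mul _ _ h', hθ, one_mul, one_mul]
    refine ⟨hh.1, ?_⟩
    simpa only [mul_inv_rev, mul_assoc, inv_inv, inv_mul_cancel_left, mul_inv_cancel_left]
      using hh.2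
  · intro g h
    rw [vertexSetoid_iff]
    simp only [MonoidHom.comp_apply, Subgroup.coe_subtype, MulEquiv.coe_toMonoidHom,
      MulAut.conj_apply]
    -- As in the partite case, fixing `[h]` means that the conjugate of `g⁻¹` by `h⁻¹ * p` is a
    -- relation; the degree of `h⁻¹ * p` is the difference of the two indices, with signs irrelevant
    -- modulo two.
    rw [map_mul, hθ, one_mul, ← inv_mem_iff (x := g),
      ← P.conj_mem_relSub_iff (i := (twoDeg S₁ U I h).toAdd) (g := h⁻¹ * p) (by
        rw [map_mul, map_inv, hp, CharTwo.sub_eq_add, ofAdd_add, ofAdd_toAdd]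
        congr 1
        generalize twoDeg S₁ U I h = z
        revert z; decide)]
    have hval : (p * g * p⁻¹ * h)⁻¹ * h
        = P.K.subtype (MulAut.conjNormal (h⁻¹ * p) g⁻¹) := by
      simp [mul_assoc]
    rw [hval, Subgroup.mem_map_iff_mem P.K.subtype_injective]
    simp
  · intro h h'
    rw [Multiplicative.toAdd.injective.eq_iff]
    constructor
    · intro hh
      refine ⟨⟨p⁻¹ * (h' * h⁻¹) * p, ?_⟩, by simp [mul_assoc]⟩
      rw [MonoidHom.mem_ker]
      simp [hh]
    · rintro ⟨g, rfl⟩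
      simp only [MonoidHom.comp_apply, Subgroup.coe_subtype, MulEquiv.coe_toMonoidHom,
        MulAut.conj_apply]
      rw [map_mul, hθ, one_mul]

/-- Conjugation by a word of odd degree identifies the two vertex groups. -/
theorem nonempty_vertexGroup_mulEquiv [hne : Nonempty (U ⊕ I)] :
    Nonempty (P.VertexGroup 0 ≃* P.VertexGroup 1) := by
  obtain ⟨s⟩ := id hne
  refine ⟨QuotientGroup.congr _ _ (MulAut.conjNormal (gen₂ s)) ?_⟩
  have hs : twoDeg S₁ U I (gen₂ s) = Multiplicative.ofAdd ((1 : ZMod 2) - 0) := by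
    rw [twoDeg_gen₂, sub_zero]
  ext k
  constructor
  · rintro ⟨k, hk, rfl⟩
    exact P.conj_mem_relSub hs hk
  · intro hk
    obtain ⟨k, rfl⟩ := (MulAut.conjNormal (H := P.K) (gen₂ s)).surjective k
    exact ⟨k, (P.conj_mem_relSub_iff hs).1 hk, rfl⟩

end TwoPartitePresentation

/-! ### The proposition -/

theorem mainTheorem7 :
    -- partite presentations, with base class `b`; the tree vertex `p` lies above the class `x`
    (∀ (X : Type u) (U : Type v) (I : Type w) (P : PartitePresentation X U I) (b x : X),
      ∀ p ∈ P.treeClass b x,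
        ∃ ι : P.VertexGroup x →* (P.cayley b).AutCol (P.colour b),
          Function.Injective ι ∧
          (∀ (g : P.stab x) (h : MF U I),
            (ι (QuotientGroup.mk g)).1 • P.vert b h = P.vert b (p * g * p⁻¹ * h)) ∧
          (∀ y : X, ActsRegularlyOn
            (ι.range.map ((P.cayley b).AutCol (P.colour b)).subtype) (P.vertexClass b y)) ∧
          (P.cayley b).IsNCayleyOver
            (ι.range.map ((P.cayley b).AutCol (P.colour b)).subtype) (Cardinal.mk X)) ∧
    -- 2-partite presentations, with at least one generator in `S₂ = U ∪ I`
    (∀ (S₁ : Type u) (U : Type v) (I : Type w) (P : TwoPartitePresentation S₁ U I),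
      Nonempty (U ⊕ I) →
        (∀ i : ZMod 2, ∀ p ∈ P.treeClass i,
          ∃ ι : P.VertexGroup i →* P.cayley.AutCol P.colour,
            Function.Injective ι ∧
            (∀ (g : P.K) (h : MF (S₁ ⊕ U) I),
              (ι (QuotientGroup.mk g)).1 • P.vert h = P.vert (p * g * p⁻¹ * h)) ∧
            (∀ j : ZMod 2, ActsRegularlyOn
              (ι.range.map (P.cayley.AutCol P.colour).subtype) (P.vertexClass j)) ∧
            P.cayley.IsNCayleyOver
              (ι.range.map (P.cayley.AutCol P.colour).subtype) (2 : Cardinal.{0})) ∧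
        Nonempty (P.VertexGroup 0 ≃* P.VertexGroup 1) ∧
        P.cayley.IsBiCayley) := by
  refine ⟨fun X U I P b x p hp => P.exists_vertexGroup_action b x p hp,
    fun S₁ U I P hne => ⟨fun i p hp => P.exists_vertexGroup_action i p hp,
      P.nonempty_vertexGroup_mulEquiv, ?_⟩⟩
  -- Any base vertex would do; the identity lies in `Ṽ_0 = K`.
  obtain ⟨ι, -, -, -, h⟩ := P.exists_vertexGroup_action 0 1 (map_one _)
  exact ⟨_, h⟩
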